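/- Let $K$ be a real separable Hilbert space and let $S:\mathcal D(S)\subset K\to K$ be a positive self-adjoint operator, i.e. $S=S^*$ and $\langle Sx,x\rangle_K>0$ for all $0\ne x\in\mathcal D(S)$. Let $S^{1/2}$ be its positive self-adjoint square root and let $M=\mathcal D(S^{1/2})\times K$ carry the inner product $$\langle (y_1,z_1),(y_2,z_2)\rangle_M=\langle S^{1/2}y_1,S^{1/2}y_2\rangle_K+\langle z_1,z_2\rangle_K .$$ Let $A(y,z)=(z,-Sy)$ with $\mathcal D(A)=\mathcal D(S)\times\mathcal D(S^{1/2})\subset M$, let $e^{tA}$, $t\in\mathbb R$, be the contractive strongly continuous group on $M$ generated by $A$, and let $G:K\to M$, $Gu=(0,u)$. For $k\in M$ and a control $u\in L^2(0,t;K)$, the solution of $w'=Aw+Gu$, $w(0)=k$, on $[0,t]$ is the mild solution $$w(\tau)=e^{\tau A}k+\int_0^\tau e^{(\tau-s)A}Gu(s)\,ds,\qquad 0\le\tau\le t$$ (if $M$ is not complete, the integral is taken in the completion of $M$, and the equation is required to hold with values $w(\tau)\in M$). The minimal energy $\mathcal E_C(t,k)$ is the infimum of $\big(\int_0^t|u(r)|_K^2\,dr\big)^{1/2}$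 over all $u\in L^2(0,t;K)$ for which $w(t)=0$ (and $+\infty$ if there is no such $u$). **Theorem.** There exists a positive constant $C$ such that, for every $k=(0,a)\in\operatorname{Im}G$, $a\in K$, and every $t>0$, $$\mathcal E_C(t,k)\le\frac{C\,|k|_M}{t^{1/2}}=\frac{C\,|a|_K}{t^{1/2}} .$$ -/

import Mathlib

open MeasureTheory Set
open scoped ENNReal

noncomputable section

namespace AbstractWave

universe u

/-- A positive self-adjoint (possibly unbounded) operator `S : D(S) ⊆ K → K` on a real Hilbert
space: `S` equals its adjoint (in particular `D(S)` is dense) and `⟪S x, x⟫ > 0` for every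
nonzero `x ∈ D(S)`. -/
structure PositiveSelfAdjoint (K : Type u) [NormedAddCommGroup K] [InnerProductSpace ℝ K]
    [CompleteSpace K] where
  /-- the operator with its domain -/
  op : K →ₗ.[ℝ] K
  isSelfAdjoint : IsSelfAdjoint op
  pos : ∀ x : op.domain, (x : K) ≠ 0 → 0 < inner ℝ (op x) (x : K)

section

variable {K : Type u} [NormedAddCommGroup K] [InnerProductSpace ℝ K] [CompleteSpace K]

/-- `R` is a nonnegative self-adjoint square root of `S`: `R` is self-adjoint, `⟪R x, x⟫ ≥ 0` on
`D(R)`, and `S = R ∘ R` as unbounded operators, that is `D(S) = {x ∈ D(R) | R x ∈ D(R)}` and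
`S x = R (R x)` there. -/
structure IsPositiveSqrt (R S : K →ₗ.[ℝ] K) : Prop where
  isSelfAdjoint : IsSelfAdjoint R
  nonneg : ∀ x : R.domain, 0 ≤ inner ℝ (R x) (x : K)
  graph_iff : ∀ x y : K, (x, y) ∈ S.graph ↔ ∃ z : K, (x, z) ∈ R.graph ∧ (z, y) ∈ R.graph

namespace PositiveSelfAdjoint

variable (S : PositiveSelfAdjoint K)

open Classical in
/-- `S^{1/2}`, the (unique) nonnegative self-adjoint square root of the positive self-adjoint
operator `S`. -/
def sqrt : K →ₗ.[ℝ] K :=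
  if h : ∃ R : K →ₗ.[ℝ] K, IsPositiveSqrt R S.op then h.choose else ⊥

/-- `S^{1/2}` is injective. -/
theorem sqrt_injective : Function.Injective S.sqrt.toFun := by
  rw [injective_iff_map_eq_zero]
  intro x hx
  by_cases h : ∃ R : K →ₗ.[ℝ] K, IsPositiveSqrt R S.op
  · have hR : IsPositiveSqrt S.sqrt S.op := by
      rw [sqrt, dif_pos h]
      exact h.choose_spec
    have hx0 : ((x : K), (0 : K)) ∈ S.sqrt.graph := by
      rw [LinearPMap.mem_graph_iff]
      exact ⟨x, rfl, hx⟩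
    have hS : ((x : K), (0 : K)) ∈ S.op.graph :=
      (hR.graph_iff _ _).2 ⟨0, hx0, S.sqrt.graph.zero_mem⟩
    obtain ⟨y, hy, hy0⟩ := (LinearPMap.mem_graph_iff _).1 hS
    by_contra hne
    have hyne : (y : K) ≠ 0 := by
      rw [hy]
      exact fun h0 => hne (Subtype.ext h0)
    have := S.pos y hyne
    rw [hy0, inner_zero_left] at this
    exact lt_irrefl _ this
  · have hbot : S.sqrt = ⊥ := by rw [sqrt, dif_neg h]
    have hmem : (x : K) ∈ (⊥ : K →ₗ.[ℝ] K).domain := hbot ▸ x.2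
    exact Subtype.ext ((Submodule.mem_bot ℝ).1 hmem)

/-- The domain `D(S^{1/2})` as a space of its own, which carries the norm `|S^{1/2} y|_K`
instead of the norm of `K`. -/
def HalfDomain : Type u := S.sqrt.domain

instance : AddCommGroup S.HalfDomain := inferInstanceAs (AddCommGroup S.sqrt.domain)

instance : Module ℝ S.HalfDomain := inferInstanceAs (Module ℝ S.sqrt.domain)

/-- The inclusion `D(S^{1/2}) → K`. -/
def incl : S.HalfDomain →ₗ[ℝ] K := S.sqrt.domain.subtype

/-- `S^{1/2}` as a linear map `D(S^{1/2}) → K`. -/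
def sqrtMap : S.HalfDomain →ₗ[ℝ] K := S.sqrt.toFun

/-- The inner product `⟪S^{1/2} y₁, S^{1/2} y₂⟫_K` on `D(S^{1/2})`. -/
@[reducible]
def halfCore : InnerProductSpace.Core ℝ S.HalfDomain where
  inner y₁ y₂ := inner ℝ (S.sqrtMap y₁) (S.sqrtMap y₂)
  conj_inner_symm _ _ := inner_conj_symm _ _
  re_inner_nonneg _ := inner_self_nonneg
  add_left _ _ _ := by rw [map_add, inner_add_left]
  smul_left _ _ _ := by rw [map_smul, inner_smul_left]
  definite y hy := S.sqrt_injective ((inner_self_eq_zero.1 hy).trans (map_zero S.sqrtMap).symm)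

instance : NormedAddCommGroup S.HalfDomain := S.halfCore.toNormedAddCommGroup

instance : InnerProductSpace ℝ S.HalfDomain := InnerProductSpace.ofCore S.halfCore.toCore

/-- The state space `M = D(S^{1/2}) × K` with the inner product
`⟪(y₁, z₁), (y₂, z₂)⟫ = ⟪S^{1/2} y₁, S^{1/2} y₂⟫_K + ⟪z₁, z₂⟫_K`. -/
abbrev State : Type u := WithLp 2 (S.HalfDomain × K)

/-- The wave operator `A (y, z) = (z, -S y)` with domain `D(A) = D(S) × D(S^{1/2})`. -/
def waveOp : S.State →ₗ.[ℝ] S.State where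
  domain :=
    { carrier := {w | S.incl w.fst ∈ S.op.domain ∧ w.snd ∈ S.sqrt.domain}
      add_mem' := fun {v w} hv hw => by
        refine ⟨?_, S.sqrt.domain.add_mem hv.2 hw.2⟩
        rw [WithLp.add_fst, map_add]
        exact S.op.domain.add_mem hv.1 hw.1
      zero_mem' := by
        refine ⟨?_, S.sqrt.domain.zero_mem⟩
        rw [WithLp.zero_fst, map_zero]
        exact S.op.domain.zero_mem
      smul_mem' := fun c w hw => by
        refine ⟨?_, S.sqrt.domain.smul_mem c hw.2⟩
        rw [WithLp.smul_fst, map_smul]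
        exact S.op.domain.smul_mem c hw.1 }
  toFun :=
    { toFun := fun w => WithLp.toLp 2
        ((⟨(w : S.State).snd, w.2.2⟩ : S.sqrt.domain), - S.op ⟨S.incl (w : S.State).fst, w.2.1⟩)
      map_add' := fun v w => by
        apply WithLp.ofLp_injective 2
        refine Prod.ext rfl ?_
        have h := S.op.map_add ⟨S.incl (v : S.State).fst, v.2.1⟩ ⟨S.incl (w : S.State).fst, w.2.1⟩
        exact (congrArg Neg.neg h).trans (neg_add _ _)
      map_smul' := fun c w => by
        apply WithLp.ofLp_injective 2
        refine Prod.ext rfl ?_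
        have h := S.op.map_smul c ⟨S.incl (w : S.State).fst, w.2.1⟩
        exact (congrArg Neg.neg h).trans (smul_neg c _).symm }

/-- The control operator `G : K → M`, `G u = (0, u)`. -/
def control : K →ₗ[ℝ] S.State :=
  (WithLp.linearEquiv 2 ℝ (S.HalfDomain × K)).symm.toLinearMap ∘ₗ LinearMap.inr ℝ S.HalfDomain K

end PositiveSelfAdjoint

end

/-- `T` is the contractive (strongly continuous, one-parameter) group `e^{tA}`, `t ∈ ℝ`, generated
by the unbounded operator `A`: the group law, `‖T t‖ ≤ 1`, strong continuity, and `A` is exactly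
the infinitesimal generator, that is `x ∈ D(A)` and `A x = y` if and only if `t ↦ T t x` has
derivative `y` at `0`. -/
structure IsContractionGroupGeneratedBy {M : Type u} [NormedAddCommGroup M] [NormedSpace ℝ M]
    (T : ℝ → M →L[ℝ] M) (A : M →ₗ.[ℝ] M) : Prop where
  zero : T 0 = ContinuousLinearMap.id ℝ M
  add : ∀ s t : ℝ, T (s + t) = (T s).comp (T t)
  norm_le_one : ∀ t : ℝ, ‖T t‖ ≤ 1
  continuous : ∀ x : M, Continuous fun t : ℝ => T t x
  generator : ∀ x y : M, (x, y) ∈ A.graph ↔ HasDerivAt (fun t : ℝ => T t x) y 0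

namespace PositiveSelfAdjoint

variable {K : Type u} [NormedAddCommGroup K] [InnerProductSpace ℝ K] [CompleteSpace K]
  (S : PositiveSelfAdjoint K)

/-- `w` is the mild solution on `[0, t]` of `w' = A w + G u`, `w(0) = k`, where `A` generates the
contractive group `e^{τA}`:
`w(τ) = e^{τA} k + ∫₀^τ e^{(τ-s)A} G u(s) ds` for `τ ∈ [0, t]`.
The equation is between elements of `M`; the Bochner integral is formed in the completion of `M`
(which is `M` itself if `M` is complete, that is, if `S` is bounded below by a positive
constant). -/
def IsMildSolution (t : ℝ) (k : S.State) (u : ℝ → K) (w : ℝ → S.State) : Prop :=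
  ∃ T : ℝ → S.State →L[ℝ] S.State, IsContractionGroupGeneratedBy T S.waveOp ∧
    ∀ τ ∈ Icc 0 t, (w τ : UniformSpace.Completion S.State) =
      (T τ k : UniformSpace.Completion S.State) +
        ∫ s in (0 : ℝ)..τ, (T (τ - s) (S.control (u s)) : UniformSpace.Completion S.State)

/-- The minimal energy `E_C(t, k)`: the infimum of `(∫₀^t |u(r)|_K² dr)^{1/2}` over all controls
`u ∈ L²(0, t; K)` that drive the solution from `k` to `0` in time `t`. It is `∞` if there is
no such control. -/
def minimalEnergy (t : ℝ) (k : S.State) : ℝ≥0∞ :=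
  ⨅ (u : ℝ → K) (_ : MemLp u 2 (volume.restrict (Ioo 0 t)))
    (_ : ∃ w : ℝ → S.State, S.IsMildSolution t k u w ∧ w t = 0),
    ENNReal.ofReal (√(∫ r in Ioo 0 t, ‖u r‖ ^ 2))

end PositiveSelfAdjoint

end AbstractWave

end

/-! Cut off the free wave. Let `σ(s)` and `c(s) = σ'(s)` be the position and velocity of the
uncontrolled wave started at `(0, a)`, and multiply the position by a scalar cutoff `θ`. Since `σ''
= -Sσ`, the product `θσ` solves the wave equation with control `u = 2θ'c + θ''σ`. It starts from
`(0, a)` if `θ(0) = 1`, because `σ(0) = 0` makes `θ'(0)` irrelevant, and it is at rest at time `t`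
if `θ(t) = θ'(t) = 0`. The choice `θ(s) = (1 - s/t)²`, with `|c| ≤ |a|` and `|σ(s)| ≤ s|a|`, gives
`|u| ≤ 6|a|/t`, hence energy at most `6|a|/√t`. This is `hasDerivAt_cutoff`, `isMildSolution_cutoff`
and `minimalEnergy_control_le`.

The definitions refer to `S^{1/2}` and to a group generated by `A`, so both must be shown to exist.
`exists_isPositiveSqrt` obtains the root of `S` from bounded roots of `J = (1 + S)⁻¹` and `1 - J`.
For the group, `(y, z) ↦ (S^{1/2}y, z)` embeds the possibly incomplete `M` isometrically in the
Hilbert space `K × K` and turns `A` into the skew-adjoint `(p, q) ↦ (S^{1/2}q, -S^{1/2}p)`. Stone's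
theorem (`IsSkewAdjoint.exists_group`) gives an orthogonal group there, and `exists_waveGroup`
restricts it to `M`. -/

open Filter Topology

namespace AbstractWave

/-! ### Resolvents of monotone linear relations. -/

section Resolvent

variable {H : Type*} [NormedAddCommGroup H] [InnerProductSpace ℝ H] [CompleteSpace H]

/-- A closed monotone linear relation `Γ` whose adjoint is monotone has a contractive
everywhere defined resolvent `(1 + Γ)⁻¹`. -/
theorem exists_resolvent (Γ : Submodule ℝ (H × H)) (hc : IsClosed (Γ : Set (H × H)))
    (hm : ∀ p ∈ Γ, 0 ≤ inner ℝ p.1 p.2)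
    (ha : ∀ z w : H, (∀ p ∈ Γ, inner ℝ p.2 z = inner ℝ p.1 w) → 0 ≤ inner ℝ z w) :
    ∃ J : H →L[ℝ] H, (∀ f, (J f, f - J f) ∈ Γ) ∧ (∀ p ∈ Γ, J (p.1 + p.2) = p.1) ∧
      ∀ f, ‖J f‖ ≤ ‖f‖ := by
  have hsq : ∀ p ∈ Γ, ‖p.1‖ ^ 2 + ‖p.2‖ ^ 2 ≤ ‖p.1 + p.2‖ ^ 2 := by
    intro p hp
    rw [norm_add_sq_real]
    linarith [hm p hp]
  have h1 : ∀ p ∈ Γ, ‖p.1‖ ≤ ‖p.1 + p.2‖ := fun p hp =>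
    le_of_sq_le_sq (by nlinarith [hsq p hp, sq_nonneg ‖p.2‖]) (norm_nonneg _)
  have h2 : ∀ p ∈ Γ, ‖p.2‖ ≤ ‖p.1 + p.2‖ := fun p hp =>
    le_of_sq_le_sq (by nlinarith [hsq p hp, sq_nonneg ‖p.1‖]) (norm_nonneg _)
  let s : Γ →L[ℝ] H := (ContinuousLinearMap.fst ℝ H H + ContinuousLinearMap.snd ℝ H H).comp Γ.subtypeL
  have hs : ∀ p : Γ, s p = (p : H × H).1 + (p : H × H).2 := fun p => rfl
  have : CompleteSpace Γ := hc.completeSpace_coe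
  have hanti : AntilipschitzWith 1 s := by
    refine s.antilipschitz_of_bound fun p => ?_
    rw [NNReal.coe_one, one_mul, hs]
    exact max_le (h1 p p.2) (h2 p p.2)
  have hcl : IsClosed (LinearMap.range (s : Γ →ₗ[ℝ] H) : Set H) := by
    rw [LinearMap.coe_range]
    exact hanti.isClosed_range s.uniformContinuous
  have : CompleteSpace (LinearMap.range (s : Γ →ₗ[ℝ] H)) := hcl.completeSpace_coe
  have htop : LinearMap.range (s : Γ →ₗ[ℝ] H) = ⊤ := by
    rw [← Submodule.orthogonal_eq_bot_iff, Submodule.eq_bot_iff]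
    intro z hz
    -- A vector `z` orthogonal to the range of `1 + Γ` puts `(z, -z)` in the adjoint relation, whose
    -- monotonicity forces `-‖z‖² ≥ 0`.
    have hz' : 0 ≤ inner ℝ z (-z) := by
      refine ha z (-z) fun p hp => ?_
      have := (Submodule.mem_orthogonal _ _).1 hz (s ⟨p, hp⟩) ⟨⟨p, hp⟩, rfl⟩
      rw [hs, inner_add_left] at this
      rw [inner_neg_right]
      linarith
    rw [inner_neg_right, real_inner_self_eq_norm_sq] at hz'
    have : ‖z‖ ^ 2 = 0 := le_antisymm (by linarith) (sq_nonneg _)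
    simpa using this
  have hsurj : ∀ f, ∃ p : Γ, s p = f := fun f => by
    have : f ∈ LinearMap.range (s : Γ →ₗ[ℝ] H) := htop ▸ Submodule.mem_top
    exact this
  choose g hg using hsurj
  have hgs : ∀ p, g (s p) = p := fun p => hanti.injective (hg _)
  let J : H →ₗ[ℝ] H :=
    { toFun := fun f => (g f : H × H).1
      map_add' := fun x y => by
        have : g (x + y) = g x + g y := hanti.injective (by rw [map_add, hg, hg, hg])
        rw [this]; rfl
      map_smul' := fun c x => by
        have : g (c • x) = c • g x := hanti.injective (by rw [map_smul, hg, hg])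
        rw [this]; rfl }
  have hJ : ∀ f, ‖J f‖ ≤ ‖f‖ := fun f => by
    have := h1 (g f) (g f).2
    rwa [← hs, hg] at this
  refine ⟨J.mkContinuous 1 fun f => by simpa using hJ f, fun f => ?_, fun p hp => ?_, hJ⟩
  · have h := hg f
    rw [hs] at h
    have : ((g f : H × H).1, f - (g f : H × H).1) = (g f : H × H) :=
      Prod.ext rfl (by rw [sub_eq_iff_eq_add']; exact h.symm)
    exact this ▸ (g f).2
  · exact congrArg (fun q : Γ => (q : H × H).1) (hgs ⟨p, hp⟩)

end Resolvent

/-! ### Square roots of bounded operators by iteration. -/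

section BoundedSqrt

variable {𝔸 : Type*} [NormedRing 𝔸] [NormedAlgebra ℝ 𝔸]

/-- The iteration `Y ↦ (X + Y²) / 2`, whose limit `Y` satisfies `(1 - Y)² = 1 - X`. -/
noncomputable def sqrtIter (X : 𝔸) : ℕ → 𝔸
  | 0 => 0
  | n + 1 => (1 / 2 : ℝ) • (X + sqrtIter X n ^ 2)

theorem Commute.sqrtIter_right {X Z : 𝔸} (h : Commute Z X) (n : ℕ) : Commute Z (sqrtIter X n) := by
  induction n with
  | zero => exact Commute.zero_right Z
  | succ n ih => exact (h.add_right (ih.pow_right 2)).smul_right _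

/-- The scalar iteration with `X = 1` is the majorant of the iteration for every contraction; being
increasing and bounded by `1`, it makes the increments summable. -/
theorem sqrtIter_one_bounds (n : ℕ) :
    0 ≤ sqrtIter (1 : ℝ) n ∧ sqrtIter (1 : ℝ) n ≤ sqrtIter (1 : ℝ) (n + 1) ∧
      sqrtIter (1 : ℝ) (n + 1) ≤ 1 := by
  induction n with
  | zero => norm_num [sqrtIter]
  | succ n ih =>
    obtain ⟨h0, h1, h2⟩ := ih
    have e : sqrtIter (1 : ℝ) (n + 1 + 1) = (1 / 2) * (1 + sqrtIter (1 : ℝ) (n + 1) ^ 2) := rfl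
    refine ⟨h0.trans h1, ?_, ?_⟩ <;> rw [e]
    · nlinarith [sq_nonneg (sqrtIter (1 : ℝ) (n + 1) - 1)]
    · nlinarith

theorem norm_sqrtIter_le {X : 𝔸} (hX : ‖X‖ ≤ 1) (n : ℕ) : ‖sqrtIter X n‖ ≤ sqrtIter (1 : ℝ) n := by
  induction n with
  | zero => simp [sqrtIter]
  | succ n ih =>
    have h : ‖sqrtIter X n ^ 2‖ ≤ sqrtIter (1 : ℝ) n ^ 2 := by
      rw [sq, sq]
      exact (norm_mul_le _ _).trans (mul_le_mul ih ih (norm_nonneg _) (sqrtIter_one_bounds n).1)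
    calc ‖sqrtIter X (n + 1)‖ ≤ (1 / 2) * ‖X + sqrtIter X n ^ 2‖ := by
          rw [sqrtIter, norm_smul]; norm_num
      _ ≤ (1 / 2) * (1 + sqrtIter (1 : ℝ) n ^ 2) := by
          gcongr
          exact (norm_add_le _ _).trans (add_le_add hX h)

/-- Consecutive iterates commute, so the next increment is half of their sum times their difference.
The scalar iteration obeys the same identity, and the two are compared factor by factor. -/
theorem norm_sqrtIter_succ_sub_le {X : 𝔸} (hX : ‖X‖ ≤ 1) (n : ℕ) :
    ‖sqrtIter X (n + 1) - sqrtIter X n‖ ≤ sqrtIter (1 : ℝ) (n + 1) - sqrtIter (1 : ℝ) n := by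
  induction n with
  | zero =>
    have := norm_sqrtIter_le hX 1
    simpa [sqrtIter] using this
  | succ n ih =>
    have hcomm : Commute (sqrtIter X (n + 1)) (sqrtIter X n) :=
      Commute.sqrtIter_right (Commute.sqrtIter_right (Commute.refl X) (n + 1)).symm n
    have e : sqrtIter X (n + 1 + 1) - sqrtIter X (n + 1) = (1 / 2 : ℝ) •
        ((sqrtIter X (n + 1) + sqrtIter X n) * (sqrtIter X (n + 1) - sqrtIter X n)) := by
      rw [← hcomm.sq_sub_sq, sqrtIter, sqrtIter, ← smul_sub, add_sub_add_left_eq_sub]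
    have e1 : sqrtIter (1 : ℝ) (n + 1 + 1) - sqrtIter (1 : ℝ) (n + 1) = (1 / 2) *
        ((sqrtIter (1 : ℝ) (n + 1) + sqrtIter (1 : ℝ) n) *
          (sqrtIter (1 : ℝ) (n + 1) - sqrtIter (1 : ℝ) n)) := by
      change (1 / 2) * (1 + sqrtIter (1 : ℝ) (n + 1) ^ 2) -
        (1 / 2) * (1 + sqrtIter (1 : ℝ) n ^ 2) = _
      ring
    rw [e, e1, norm_smul]
    have hh : ‖(1 / 2 : ℝ)‖ = 1 / 2 := by norm_num
    rw [hh]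
    have := sqrtIter_one_bounds n
    gcongr
    refine (norm_mul_le _ _).trans (mul_le_mul ?_ ih (norm_nonneg _) (by linarith))
    exact (norm_add_le _ _).trans (add_le_add (norm_sqrtIter_le hX _) (norm_sqrtIter_le hX _))

/-- A contraction `X` has an element `Y` of norm at most one with `(1 - Y)² = 1 - X`, the limit of
the iteration `sqrtIter X`. -/
theorem exists_one_sub_sq_eq [CompleteSpace 𝔸] {X : 𝔸} (hX : ‖X‖ ≤ 1) :
    ∃ Y : 𝔸, ‖Y‖ ≤ 1 ∧ (1 - Y) ^ 2 = 1 - X ∧ Tendsto (sqrtIter X) atTop (𝓝 Y) := by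
  have hmono : Monotone (sqrtIter (1 : ℝ)) :=
    monotone_nat_of_le_succ fun n => (sqrtIter_one_bounds n).2.1
  have hle : ∀ n, sqrtIter (1 : ℝ) n ≤ 1 := fun n =>
    (sqrtIter_one_bounds n).2.1.trans (sqrtIter_one_bounds n).2.2
  have hsum : Summable fun n => sqrtIter (1 : ℝ) (n + 1) - sqrtIter (1 : ℝ) n := by
    refine summable_of_sum_range_le (c := 1)
      (fun n => sub_nonneg.2 (sqrtIter_one_bounds n).2.1) fun n => ?_
    rw [Finset.sum_range_sub]
    simpa [sqrtIter] using hle n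
  have hcau : CauchySeq (sqrtIter X) :=
    cauchySeq_of_dist_le_of_summable _ (fun n => by
      rw [dist_comm, dist_eq_norm]; exact norm_sqrtIter_succ_sub_le hX n) hsum
  obtain ⟨Y, hY⟩ := cauchySeq_tendsto_of_complete hcau
  refine ⟨Y, ?_, ?_, hY⟩
  · exact le_of_tendsto hY.norm (Eventually.of_forall fun n => (norm_sqrtIter_le hX n).trans (hle n))
  · have h1 : Tendsto (fun n => sqrtIter X (n + 1)) atTop (𝓝 ((1 / 2 : ℝ) • (X + Y ^ 2))) :=
      ((hY.pow 2).const_add X).const_smul (1 / 2 : ℝ)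
    have h2 : Y = (1 / 2 : ℝ) • (X + Y ^ 2) :=
      tendsto_nhds_unique (hY.comp (tendsto_add_atTop_nat 1)) h1
    have h3 : Y + Y = X + Y ^ 2 := by
      nth_rewrite 1 2 [h2]
      rw [← add_smul]; norm_num
    have : (1 - Y) ^ 2 = 1 - (Y + Y) + Y ^ 2 := by noncomm_ring
    rw [this, h3]; abel

end BoundedSqrt

section BoundedOperators

variable {H : Type*} [NormedAddCommGroup H] [InnerProductSpace ℝ H] [CompleteSpace H]

/-- The positive square root of `1 - X`, for a self-adjoint contraction `X`. -/
theorem exists_sqrt_one_sub {X : H →L[ℝ] H} (hX : ‖X‖ ≤ 1) (hs : IsSelfAdjoint X) :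
    ∃ Q : H →L[ℝ] H, IsSelfAdjoint Q ∧ (∀ x, 0 ≤ inner ℝ (Q x) x) ∧ Q * Q = 1 - X ∧
      (∀ Z, Commute Z X → Commute Z Q) ∧ ‖1 - Q‖ ≤ 1 := by
  obtain ⟨Y, hY1, hY2, hY⟩ := exists_one_sub_sq_eq hX
  refine ⟨1 - Y, ?_, fun x => ?_, by rw [← sq, hY2], fun Z hZ => ?_,
    by rwa [sub_sub_cancel]⟩
  · refine (IsSelfAdjoint.one _).sub ?_
    have hn : ∀ n, IsSelfAdjoint (sqrtIter X n) := fun n => by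
      induction n with
      | zero => exact IsSelfAdjoint.zero _
      | succ n ih => exact (IsSelfAdjoint.all (1 / 2 : ℝ)).smul (hs.add (ih.pow 2))
    exact tendsto_nhds_unique (hY.star.congr fun n => hn n) hY
  · have h1 : inner ℝ (Y x) x ≤ ‖x‖ ^ 2 := by
      refine (real_inner_le_norm _ _).trans ?_
      rw [sq]
      gcongr
      simpa using (Y.le_opNorm x).trans (mul_le_mul_of_nonneg_right hY1 (norm_nonneg x))
    have h2 : (1 - Y) x = x - Y x := rfl
    rw [h2, inner_sub_left, real_inner_self_eq_norm_sq]
    linarith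
  · refine (Commute.one_right Z).sub_right ?_
    refine tendsto_nhds_unique ((hY.const_mul Z).congr fun n => ?_) (hY.mul_const Z)
    exact Commute.sqrtIter_right hZ n

end BoundedOperators

/-! ### The square root of an unbounded positive self-adjoint operator. -/

section Sqrt

variable {K : Type*} [NormedAddCommGroup K] [InnerProductSpace ℝ K] [CompleteSpace K]

/-- Self-adjointness in terms of the graph alone, which avoids domain bookkeeping in all later
arguments. -/
theorem mem_graph_iff_of_isSelfAdjoint {A : K →ₗ.[ℝ] K} (hA : IsSelfAdjoint A) (x y : K) :
    (x, y) ∈ A.graph ↔ ∀ a b, (a, b) ∈ A.graph → inner ℝ b x = inner ℝ a y := by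
  have h := LinearPMap.adjoint_graph_eq_graph_adjoint hA.dense_domain
  rw [LinearPMap.isSelfAdjoint_def.1 hA] at h
  conv_lhs => rw [h]
  simp only [Submodule.mem_adjoint_iff, sub_eq_zero]

theorem isSelfAdjoint_of_mem_graph_iff {A : K →ₗ.[ℝ] K} (hd : Dense (A.domain : Set K))
    (hA : ∀ x y, (x, y) ∈ A.graph ↔ ∀ a b, (a, b) ∈ A.graph → inner ℝ b x = inner ℝ a y) :
    IsSelfAdjoint A := by
  refine LinearPMap.eq_of_eq_graph ?_
  change (LinearPMap.adjoint A).graph = A.graph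
  rw [LinearPMap.adjoint_graph_eq_graph_adjoint hd]
  ext ⟨x, y⟩
  rw [hA x y]
  simp only [Submodule.mem_adjoint_iff, sub_eq_zero]

/-- The resolvent `(1 + S)⁻¹` of a positive self-adjoint operator. -/
theorem PositiveSelfAdjoint.exists_resolvent (S : PositiveSelfAdjoint K) :
    ∃ J : K →L[ℝ] K, (∀ x y, (x, y) ∈ S.op.graph ↔ x = J (x + y)) ∧ ‖J‖ ≤ 1 ∧ ‖1 - J‖ ≤ 1 ∧
      IsSelfAdjoint J := by
  have hm : ∀ x y, (x, y) ∈ S.op.graph → 0 ≤ inner ℝ x y := by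
    intro x y h
    obtain ⟨v, hv, hv'⟩ := (LinearPMap.mem_graph_iff _).1 h
    dsimp only at hv hv'
    by_cases hx : x = 0
    · simp [hx]
    · have := S.pos v (hv ▸ hx)
      rw [hv, hv', real_inner_comm] at this
      exact this.le
  obtain ⟨J, h1, h2, h3⟩ := AbstractWave.exists_resolvent S.op.graph
    S.isSelfAdjoint.isClosed (fun p hp => hm _ _ hp)
    (fun z w h => hm _ _ ((mem_graph_iff_of_isSelfAdjoint S.isSelfAdjoint z w).2
      fun a b hab => h (a, b) hab))
  refine ⟨J, fun x y => ⟨fun h => (h2 _ h).symm, fun h => ?_⟩, ?_, ?_, ?_⟩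
  · have := h1 (x + y)
    rwa [← h, add_sub_cancel_left] at this
  · exact J.opNorm_le_bound zero_le_one fun f => by simpa using h3 f
  · refine ContinuousLinearMap.opNorm_le_bound _ zero_le_one fun f => ?_
    rw [one_mul]
    refine le_of_sq_le_sq ?_ (norm_nonneg _)
    -- The summands of `f = J f + (f - J f)` have nonnegative inner product, so each is no longer
    -- than `f`.
    have h4 := hm _ _ (h1 f)
    have h5 : (1 - J) f = f - J f := rfl
    have h6 : f = J f + (f - J f) := by abel
    rw [h5]
    conv_rhs => rw [h6, norm_add_sq_real]
    nlinarith [sq_nonneg ‖J f‖]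
  · rw [ContinuousLinearMap.isSelfAdjoint_iff_isSymmetric]
    intro f g
    have h4 := (mem_graph_iff_of_isSelfAdjoint S.isSelfAdjoint _ _).1 (h1 g) _ _ (h1 f)
    rw [inner_sub_left, inner_sub_right] at h4
    change inner ℝ (J f) g = inner ℝ f (J g)
    linarith

/-- With `ρ = J^{1/2}` and `θ = (1 - J)^{1/2}`, formally `S = θ²ρ⁻²`, so the root should be `θρ⁻¹`.
Its graph is taken to be `{(x, y) | θ x = ρ y}`, which is the set of pairs `(ρ v, θ v)`. -/
theorem PositiveSelfAdjoint.exists_isPositiveSqrt (S : PositiveSelfAdjoint K) :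
    ∃ R : K →ₗ.[ℝ] K, IsPositiveSqrt R S.op := by
  obtain ⟨J, hJ, hJ1, hJ2, hJs⟩ := S.exists_resolvent
  obtain ⟨ρ, hρs, hρ0, hρ, hρc, -⟩ := exists_sqrt_one_sub hJ2 ((IsSelfAdjoint.one _).sub hJs)
  obtain ⟨θ, hθs, hθ0, hθ, hθc, hθ1⟩ := exists_sqrt_one_sub hJ1 hJs
  rw [sub_sub_cancel] at hρ
  have hρJ : Commute ρ J := by rw [← hρ]; exact (Commute.refl ρ).mul_right (Commute.refl ρ)
  have hcomm : Commute ρ θ := hθc ρ hρJ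
  have hc : ∀ x, ρ (θ x) = θ (ρ x) := fun x => congrArg (fun T : K →L[ℝ] K => T x) hcomm.eq
  have hρ' : ∀ x, ρ (ρ x) = J x := fun x => congrArg (fun T : K →L[ℝ] K => T x) hρ
  have hθ' : ∀ x, θ (θ x) = x - J x := fun x => congrArg (fun T : K →L[ℝ] K => T x) hθ
  have hρs' : ∀ x y, inner ℝ (ρ x) y = inner ℝ x (ρ y) := fun x y =>
    (ContinuousLinearMap.isSelfAdjoint_iff_isSymmetric.1 hρs) x y
  have hθs' : ∀ x y, inner ℝ (θ x) y = inner ℝ x (θ y) := fun x y =>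
    (ContinuousLinearMap.isSelfAdjoint_iff_isSymmetric.1 hθs) x y
  -- A product of commuting positive operators is positive: with `q² = θ`, the form equals `⟪ρ (q
  -- x), q x⟫`. The root `q` is available because `‖1 - θ‖ ≤ 1`.
  have hpos : ∀ x, 0 ≤ inner ℝ (θ x) (ρ x) := by
    obtain ⟨q, hqs, -, hq, hqc, -⟩ := exists_sqrt_one_sub hθ1 ((IsSelfAdjoint.one _).sub hθs)
    rw [sub_sub_cancel] at hq
    intro x
    have h1 : q (ρ x) = ρ (q x) :=
      (congrArg (fun T : K →L[ℝ] K => T x) (hqc ρ ((Commute.one_right ρ).sub_right hcomm)).eq).symm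
    have h2 : q (q x) = θ x := congrArg (fun T : K →L[ℝ] K => T x) hq
    have h3 : inner ℝ (q (q x)) (ρ x) = inner ℝ (q x) (q (ρ x)) :=
      (ContinuousLinearMap.isSelfAdjoint_iff_isSymmetric.1 hqs) (q x) (ρ x)
    rw [← h2, h3, h1, real_inner_comm]
    exact hρ0 _
  have hJinj : ∀ x, J x = 0 → x = 0 := by
    intro x hx
    have : ((0 : K), x) ∈ S.op.graph := (hJ 0 x).2 (by rw [zero_add, hx])
    exact LinearPMap.graph_fst_eq_zero_snd _ this rfl
  have hρinj : ∀ x, ρ x = 0 → x = 0 := fun x hx => hJinj x (by rw [← hρ', hx, map_zero])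
  let Γ : Submodule ℝ (K × K) := LinearMap.ker
    ((θ : K →ₗ[ℝ] K) ∘ₗ LinearMap.fst ℝ K K - (ρ : K →ₗ[ℝ] K) ∘ₗ LinearMap.snd ℝ K K)
  have hΓ : ∀ x y, (x, y) ∈ Γ ↔ θ x = ρ y := fun x y => by
    rw [LinearMap.mem_ker]; exact sub_eq_zero
  let R := Γ.toLinearPMap
  have hRΓ : R.graph = Γ := Submodule.toLinearPMap_graph_eq Γ (by
    rintro ⟨x, y⟩ hx hx'
    dsimp only at hx' ⊢
    rw [hΓ, hx', map_zero] at hx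
    exact hρinj y hx.symm)
  have hR : ∀ x y, (x, y) ∈ R.graph ↔ θ x = ρ y := fun x y => by rw [hRΓ, hΓ]
  have hpar : ∀ v, (ρ v, θ v) ∈ R.graph := fun v => (hR _ _).2 (hc v).symm
  have hsplit : ∀ x y, θ x = ρ y → ∃ v, x = ρ v ∧ y = θ v := by
    intro x y h
    -- The parameter is recovered from `ρ² + θ² = J + (1 - J) = 1`.
    refine ⟨ρ x + θ y, ?_, ?_⟩
    · rw [map_add, hc, ← h, hρ', hθ']; abel
    · rw [map_add, ← hc, h, hρ', hθ']; abel
  have hdense : Dense (R.domain : Set K) := by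
    rw [Submodule.dense_iff_topologicalClosure_eq_top, Submodule.topologicalClosure_eq_top_iff,
      Submodule.eq_bot_iff]
    intro z hz
    refine hρinj z ?_
    have := (Submodule.mem_orthogonal _ _).1 hz (ρ (ρ z))
      (LinearPMap.mem_domain_of_mem_graph (hpar _))
    rw [hρs'] at this
    exact inner_self_eq_zero.1 this
  refine ⟨R, isSelfAdjoint_of_mem_graph_iff hdense fun x y => ?_, fun x => ?_, fun x y => ?_⟩
  · rw [hR]
    constructor
    · intro h a b hab
      obtain ⟨v, ha, hb⟩ := hsplit a b ((hR _ _).1 hab)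
      rw [ha, hb, hθs', hρs', h]
    · intro h
      refine ext_inner_left ℝ fun v => ?_
      rw [← hθs', ← hρs']
      exact h _ _ (hpar v)
  · obtain ⟨v, ha, hb⟩ := hsplit _ _ ((hR _ _).1 (R.mem_graph x))
    rw [ha, hb]
    exact hpos v
  · rw [hJ]
    constructor
    · intro h
      -- With `f = x + y`, one has `x = ρρf` and `y = θθf`; the intermediate value is `ρθf`.
      refine ⟨ρ (θ (x + y)), (hR _ _).2 ?_, (hR _ _).2 ?_⟩
      · conv_lhs => rw [h]
        rw [← hρ', hc, hc]
      · rw [← hc, hθ', ← h]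
        congr 1; abel
    · rintro ⟨z, h1, h2⟩
      rw [hR] at h1 h2
      have : θ (θ x) = ρ (ρ y) := by rw [h1, ← hc, h2]
      rw [hθ', hρ'] at this
      rw [map_add, ← this]; abel

theorem PositiveSelfAdjoint.isPositiveSqrt_sqrt (S : PositiveSelfAdjoint K) :
    IsPositiveSqrt S.sqrt S.op := by
  rw [PositiveSelfAdjoint.sqrt, dif_pos S.exists_isPositiveSqrt]
  exact S.exists_isPositiveSqrt.choose_spec

end Sqrt

/-! ### Stone's theorem for skew-adjoint relations on a real Hilbert space. -/

section Stone

variable {H : Type*} [NormedAddCommGroup H] [InnerProductSpace ℝ H]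

/-- A densely defined linear relation which equals minus its adjoint. -/
structure IsSkewAdjoint (Γ : Submodule ℝ (H × H)) : Prop where
  mem_iff : ∀ x y, (x, y) ∈ Γ ↔ ∀ a b, (a, b) ∈ Γ → inner ℝ b x = -inner ℝ a y
  dense : Dense {x : H | ∃ y, (x, y) ∈ Γ}

/-- `U` is the strongly continuous orthogonal group generated by the skew-adjoint relation `Γ`. -/
structure IsOrthogonalGroup (U : ℝ → H →L[ℝ] H) (Γ : Submodule ℝ (H × H)) : Prop where
  zero : U 0 = 1
  add : ∀ s t, U (s + t) = (U s).comp (U t)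
  norm_map : ∀ t x, ‖U t x‖ = ‖x‖
  continuous : ∀ x, Continuous fun t => U t x
  integral : ∀ x y, (x, y) ∈ Γ → ∀ t, U t x - x = ∫ s in (0 : ℝ)..t, U s y

namespace IsSkewAdjoint

variable {Γ : Submodule ℝ (H × H)}

theorem inner_eq_zero (h : IsSkewAdjoint Γ) {x y : H} (hxy : (x, y) ∈ Γ) : inner ℝ x y = 0 := by
  have := (h.mem_iff x y).1 hxy x y hxy
  rw [real_inner_comm] at this
  linarith

theorem isClosed (h : IsSkewAdjoint Γ) : IsClosed (Γ : Set (H × H)) := by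
  have : (Γ : Set (H × H)) =
      ⋂ p ∈ Γ, {q : H × H | inner ℝ p.2 q.1 = -inner ℝ p.1 q.2} := by
    ext ⟨x, y⟩
    simp only [SetLike.mem_coe, h.mem_iff x y, mem_iInter, mem_ofPred_eq, Prod.forall]
  rw [this]
  exact isClosed_biInter fun p _ => isClosed_eq (by fun_prop) (by fun_prop)

variable [CompleteSpace H]

/-- Here `P = (1 + aΓ)⁻¹`. Both `aΓ` and its adjoint `-aΓ` have vanishing quadratic form, so the
monotone case applies for either sign of `a`. -/
theorem exists_resolvent (h : IsSkewAdjoint Γ) {a : ℝ} (ha : a ≠ 0) :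
    ∃ P : H →L[ℝ] H, (∀ f, ∃ y, (P f, y) ∈ Γ ∧ P f + a • y = f) ∧
      (∀ x y, (x, y) ∈ Γ → P (x + a • y) = x) ∧ ∀ f, ‖P f‖ ≤ ‖f‖ := by
  let e : H × H →L[ℝ] H × H :=
    (ContinuousLinearMap.fst ℝ H H).prod (a⁻¹ • ContinuousLinearMap.snd ℝ H H)
  let Γ' : Submodule ℝ (H × H) := Γ.comap (e : H × H →ₗ[ℝ] H × H)
  have hΓ' : ∀ x y, (x, y) ∈ Γ' ↔ (x, a⁻¹ • y) ∈ Γ := fun x y => Iff.rfl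
  obtain ⟨P, h1, h2, h3⟩ := AbstractWave.exists_resolvent Γ' (h.isClosed.preimage e.continuous)
    (fun p hp => by
      have := h.inner_eq_zero ((hΓ' p.1 p.2).1 hp)
      rw [inner_smul_right, mul_eq_zero] at this
      exact (this.resolve_left (inv_ne_zero ha)).ge)
    (fun z w hzw => by
      have hz : (z, -(a⁻¹ • w)) ∈ Γ := by
        rw [h.mem_iff]
        intro x y hxy
        have := hzw (x, a • y) ((hΓ' _ _).2 (by rwa [inv_smul_smul₀ ha]))
        dsimp only at this
        rw [inner_smul_left, RCLike.conj_to_real] at this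
        rw [inner_neg_right, neg_neg, inner_smul_right, ← this, inv_mul_cancel_left₀ ha]
      have := h.inner_eq_zero hz
      rw [inner_neg_right, inner_smul_right, neg_eq_zero, mul_eq_zero] at this
      exact (this.resolve_left (inv_ne_zero ha)).ge)
  refine ⟨P, fun f => ⟨a⁻¹ • (f - P f), h1 f, ?_⟩, fun x y hxy => ?_, h3⟩
  · rw [smul_inv_smul₀ ha, add_sub_cancel]
  · exact h2 (x, a • y) ((hΓ' _ _).2 (by rwa [inv_smul_smul₀ ha]))

/-- A skew-adjoint relation is the strong limit of commuting bounded skew-adjoint operators. -/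
theorem exists_approx (h : IsSkewAdjoint Γ) :
    ∃ B : ℕ → H →L[ℝ] H, (∀ n, B n ∈ skewAdjoint (H →L[ℝ] H)) ∧ (∀ n m, Commute (B n) (B m)) ∧
      ∀ x y, (x, y) ∈ Γ → Tendsto (fun n => B n x) atTop (𝓝 y) := by
  have hres : ∀ a : {a : ℝ // a ≠ 0}, _ := fun a => h.exists_resolvent a.2
  choose P hP1 hP2 hP3 using hres
  -- The resolvents commute with `Γ`, hence with one another.
  have hPΓ : ∀ a x y, (x, y) ∈ Γ → (P a x, P a y) ∈ Γ := by
    intro a x y hxy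
    obtain ⟨x', hx, hx'⟩ := hP1 a x
    have hy : y = (x' : H) - (x' - y) := by abel
    have key : (x', (a : ℝ)⁻¹ • (y - x')) ∈ Γ := by
      have := Γ.smul_mem (a : ℝ)⁻¹ (Γ.sub_mem hxy hx)
      have e : x - P a x = (a : ℝ) • x' := by nth_rewrite 1 [← hx']; abel
      rwa [Prod.mk_sub_mk, Prod.smul_mk, e, inv_smul_smul₀ a.2] at this
    have := hP2 a _ _ key
    rw [smul_inv_smul₀ a.2, add_sub_cancel] at this
    rwa [this]
  have hcomm : ∀ a b, Commute (P a) (P b) := by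
    intro a b
    ext f
    obtain ⟨y, hy, hf⟩ := hP1 b f
    have := hP2 b _ _ (hPΓ a _ _ hy)
    rw [← map_smul, ← map_add, hf] at this
    exact this.symm
  have hadj : ∀ a b : {a : ℝ // a ≠ 0}, (b : ℝ) = -a → ∀ f g,
      inner ℝ (P a f) g = inner ℝ f (P b g) := by
    intro a b hab f g
    obtain ⟨y, hy, hf⟩ := hP1 a f
    obtain ⟨w, hw, hg⟩ := hP1 b g
    have := (h.mem_iff _ _).1 hw _ _ hy
    nth_rewrite 1 [← hg]
    nth_rewrite 2 [← hf]
    rw [hab, inner_add_left, inner_add_right, inner_smul_right, inner_smul_left,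
      RCLike.conj_to_real, this]
    ring
  let a : ℕ → {a : ℝ // a ≠ 0} := fun n => ⟨1 / ((n : ℝ) + 1), by positivity⟩
  let b : ℕ → {a : ℝ // a ≠ 0} := fun n => ⟨-(1 / ((n : ℝ) + 1)), neg_ne_zero.2 (a n).2⟩
  have ha0 : Tendsto (fun n => (a n : ℝ)) atTop (𝓝 0) := tendsto_one_div_add_atTop_nhds_zero_nat
  have hb0 : Tendsto (fun n => (b n : ℝ)) atTop (𝓝 0) := by simpa using ha0.neg
  -- On the domain `‖P_c x - x‖ ≤ |c| ‖y‖` for `(x, y) ∈ Γ`; density and contractivity extend the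
  -- convergence to all `f`.
  have hlim : ∀ c : ℕ → {a : ℝ // a ≠ 0}, Tendsto (fun n => (c n : ℝ)) atTop (𝓝 0) → ∀ f,
      Tendsto (fun n => P (c n) f) atTop (𝓝 f) := by
    intro c hc f
    rw [Metric.tendsto_atTop]
    intro ε hε
    obtain ⟨x, ⟨y, hxy⟩, hx⟩ := h.dense.exists_dist_lt f (by positivity : 0 < ε / 3)
    have h1 : Tendsto (fun n => |(c n : ℝ)| * ‖y‖) atTop (𝓝 0) := by
      simpa using hc.abs.mul_const ‖y‖
    obtain ⟨N, hN⟩ := (Metric.tendsto_atTop.1 h1) (ε / 3) (by positivity)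
    refine ⟨N, fun n hn => ?_⟩
    have h2 := hN n hn
    rw [Real.dist_eq, sub_zero, abs_of_nonneg (by positivity)] at h2
    have h3 : ‖P (c n) x - x‖ ≤ |(c n : ℝ)| * ‖y‖ := by
      have := hP2 (c n) _ _ hxy
      rw [map_add, map_smul, ← eq_sub_iff_add_eq'] at this
      rw [norm_sub_rev, ← this, norm_smul, Real.norm_eq_abs]
      exact mul_le_mul_of_nonneg_left (hP3 _ _) (abs_nonneg _)
    have h4 := hP3 (c n) (f - x)
    rw [dist_eq_norm] at hx ⊢
    have e : P (c n) f - f = P (c n) (f - x) + (P (c n) x - x) - (f - x) := by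
      rw [map_sub]; abel
    rw [e]
    linarith [norm_sub_le (P (c n) (f - x) + (P (c n) x - x)) (f - x),
      norm_add_le (P (c n) (f - x)) (P (c n) x - x)]
  -- With `a = 1/(n+1)` this is `Γ(1 - a²Γ²)⁻¹`. It is skew because `P_a* = P_{-a}`, and on `(x, y)
  -- ∈ Γ` it equals the mean of `P_a y` and `P_{-a} y`.
  refine ⟨fun n => (2 * (a n : ℝ))⁻¹ • (P (b n) - P (a n)), fun n => ?_, fun n m => ?_,
    fun x y hxy => ?_⟩
  · have hst : star (P (a n)) = P (b n) := by
      rw [ContinuousLinearMap.star_eq_adjoint, eq_comm, ContinuousLinearMap.eq_adjoint_iff]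
      exact hadj _ _ (by simp [a, b])
    rw [skewAdjoint.mem_iff, star_smul, star_sub, hst, ← hst, star_star, hst, ← smul_neg, neg_sub]
    rfl
  · exact ((((hcomm _ _).sub_left (hcomm _ _)).sub_right
      ((hcomm _ _).sub_left (hcomm _ _))).smul_left _).smul_right _
  · have h1 : Tendsto (fun n => (2 : ℝ)⁻¹ • (P (a n) y + P (b n) y)) atTop
        (𝓝 ((2 : ℝ)⁻¹ • (y + y))) := ((hlim a ha0 y).add (hlim b hb0 y)).const_smul _
    rw [← two_smul ℝ y, inv_smul_smul₀ two_ne_zero] at h1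
    refine h1.congr fun n => ?_
    have ea := hP2 (a n) _ _ hxy
    have eb := hP2 (b n) _ _ hxy
    have hab : (b n : ℝ) = -(a n : ℝ) := rfl
    rw [map_add, map_smul] at ea eb
    rw [hab, neg_smul] at eb
    have : P (b n) x - P (a n) x = (a n : ℝ) • (P (a n) y + P (b n) y) := by
      rw [smul_add]
      have e1 : P (b n) x = x + (a n : ℝ) • P (b n) y := by nth_rewrite 2 [← eb]; abel
      have e2 : P (a n) x = x - (a n : ℝ) • P (a n) y := by nth_rewrite 2 [← ea]; abel
      rw [e1, e2]; abel
    change _ = (2 * (a n : ℝ))⁻¹ • (P (b n) x - P (a n) x)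
    rw [this, mul_inv, mul_smul, inv_smul_smul₀ (a n).2]

end IsSkewAdjoint

section Exp

variable [CompleteSpace H] {B : H →L[ℝ] H}

theorem norm_exp_smul_apply (hB : B ∈ skewAdjoint (H →L[ℝ] H)) (t : ℝ) (x : H) :
    ‖NormedSpace.exp (t • B) x‖ = ‖x‖ := by
  let +nondep : NormedAlgebra ℚ (H →L[ℝ] H) := NormedAlgebra.restrictScalars ℚ ℝ _
  have h := NormedSpace.exp_mem_unitary_of_mem_skewAdjoint (skewAdjoint.smul_mem t hB)
  exact ContinuousLinearMap.norm_map_of_mem_unitary h x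

theorem hasDerivAt_exp_smul_apply (B : H →L[ℝ] H) (t : ℝ) (x : H) :
    HasDerivAt (fun t : ℝ => NormedSpace.exp (t • B) x) (NormedSpace.exp (t • B) (B x)) t :=
  (hasDerivAt_exp_smul_const B t).clm_apply (hasDerivAt_const t x) |>.congr_deriv (by simp)

theorem integral_exp_smul_apply (B : H →L[ℝ] H) (t : ℝ) (x : H) :
    ∫ s in (0 : ℝ)..t, NormedSpace.exp (s • B) (B x) = NormedSpace.exp (t • B) x - x := by
  rw [intervalIntegral.integral_eq_sub_of_hasDerivAt
    (fun s _ => hasDerivAt_exp_smul_apply B s x)]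
  · simp
  · exact Continuous.intervalIntegrable (continuous_iff_continuousAt.2 fun s =>
      (hasDerivAt_exp_smul_apply B s (B x)).continuousAt) _ _

theorem norm_exp_smul_sub_le (hB : B ∈ skewAdjoint (H →L[ℝ] H)) (t : ℝ) (x : H) :
    ‖NormedSpace.exp (t • B) x - x‖ ≤ |t| * ‖B x‖ := by
  rw [← integral_exp_smul_apply]
  have := intervalIntegral.norm_integral_le_of_norm_le_const (a := 0) (b := t) (C := ‖B x‖)
    (f := fun s => NormedSpace.exp (s • B) (B x))
    fun s _ => (norm_exp_smul_apply hB s (B x)).le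
  rwa [sub_zero, mul_comm] at this

theorem exp_add_apply {B C : H →L[ℝ] H} (h : Commute B C) (x : H) :
    NormedSpace.exp (B + C) x = NormedSpace.exp B (NormedSpace.exp C x) := by
  let +nondep : NormedAlgebra ℚ (H →L[ℝ] H) := NormedAlgebra.restrictScalars ℚ ℝ _
  rw [NormedSpace.exp_add_of_commute h]
  rfl

/-- Factor out the isometry `exp (tC)`; what remains is `exp (t(B - C)) x - x`. This makes the
approximating groups Cauchy on the domain of `Γ`. -/
theorem norm_exp_smul_sub_exp_smul_le {C : H →L[ℝ] H} (hB : B ∈ skewAdjoint (H →L[ℝ] H))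
    (hC : C ∈ skewAdjoint (H →L[ℝ] H)) (hBC : Commute B C) (t : ℝ) (x : H) :
    ‖NormedSpace.exp (t • B) x - NormedSpace.exp (t • C) x‖ ≤ |t| * ‖B x - C x‖ := by
  have h1 : NormedSpace.exp (t • B) x =
      NormedSpace.exp (t • C) (NormedSpace.exp (t • (B - C)) x) := by
    rw [← exp_add_apply, ← smul_add, add_sub_cancel]
    exact ((hBC.symm.sub_right (Commute.refl C)).smul_left t).smul_right t
  rw [h1, ← map_sub, norm_exp_smul_apply hC]
  exact norm_exp_smul_sub_le (sub_mem hB hC) t x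

end Exp

theorem cauchySeq_of_dense {L : ℕ → H →L[ℝ] H} (hL : ∀ n x, ‖L n x‖ ≤ ‖x‖) {D : Set H}
    (hD : Dense D) (h : ∀ x ∈ D, CauchySeq fun n => L n x) (x : H) : CauchySeq fun n => L n x := by
  rw [Metric.cauchySeq_iff]
  intro ε hε
  obtain ⟨y, hy, hxy⟩ := hD.exists_dist_lt x (by positivity : 0 < ε / 3)
  obtain ⟨N, hN⟩ := Metric.cauchySeq_iff.1 (h y hy) (ε / 3) (by positivity)
  refine ⟨N, fun m hm n hn => ?_⟩
  have h1 := hN m hm n hn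
  rw [dist_eq_norm] at h1 hxy ⊢
  have e : L m x - L n x = L m (x - y) + (L m y - L n y) - L n (x - y) := by
    rw [map_sub, map_sub]; abel
  rw [e]
  linarith [norm_sub_le (L m (x - y) + (L m y - L n y)) (L n (x - y)),
    norm_add_le (L m (x - y)) (L m y - L n y), hL m (x - y), hL n (x - y)]

/-- **Stone's theorem** on a real Hilbert space: a skew-adjoint relation generates a strongly
continuous orthogonal group. -/
theorem IsSkewAdjoint.exists_group [CompleteSpace H] {Γ : Submodule ℝ (H × H)}
    (h : IsSkewAdjoint Γ) : ∃ U : ℝ → H →L[ℝ] H, IsOrthogonalGroup U Γ := by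
  obtain ⟨B, hB, hcomm, hlim⟩ := h.exists_approx
  have hnorm : ∀ n (t : ℝ) x, ‖NormedSpace.exp (t • B n) x‖ = ‖x‖ := fun n => norm_exp_smul_apply (hB n)
  have hcau : ∀ (t : ℝ) x, CauchySeq fun n => NormedSpace.exp (t • B n) x := by
    intro t
    refine cauchySeq_of_dense (fun n x => (hnorm n t x).le) h.dense ?_
    rintro x ⟨y, hxy⟩
    have h1 := (hlim x y hxy).cauchySeq
    rw [Metric.cauchySeq_iff] at h1 ⊢
    intro ε hε
    obtain ⟨N, hN⟩ := h1 (ε / (|t| + 1)) (by positivity)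
    refine ⟨N, fun m hm n hn => ?_⟩
    have h2 := hN m hm n hn
    rw [dist_eq_norm] at h2 ⊢
    rw [lt_div_iff₀ (by positivity)] at h2
    refine lt_of_le_of_lt
      (norm_exp_smul_sub_exp_smul_le (hB m) (hB n) (hcomm m n) t x) (lt_of_le_of_lt ?_ h2)
    nlinarith [norm_nonneg (B m x - B n x)]
  choose V hV using fun (t : ℝ) (x : H) => cauchySeq_tendsto_of_complete (hcau t x)
  let U : ℝ → H →L[ℝ] H := fun t => continuousLinearMapOfTendsto
    (fun n => NormedSpace.exp (t • B n)) (tendsto_pi_nhds.2 (hV t))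
  have hU : ∀ (t : ℝ) x, Tendsto (fun n => NormedSpace.exp (t • B n) x) atTop (𝓝 (U t x)) := hV
  have hUn : ∀ t x, ‖U t x‖ = ‖x‖ := fun t x =>
    tendsto_nhds_unique (hU t x).norm (by simp only [hnorm, tendsto_const_nhds])
  have hUint : ∀ x y, (x, y) ∈ Γ → ∀ t, U t x - x = ∫ s in (0 : ℝ)..t, U s y := by
    intro x y hxy t
    have h1 : Tendsto (fun n => ∫ s in (0 : ℝ)..t, NormedSpace.exp (s • B n) (B n x)) atTop
        (𝓝 (∫ s in (0 : ℝ)..t, U s y)) := by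
      obtain ⟨C, hC⟩ := (hlim x y hxy).norm.bddAbove_range
      refine intervalIntegral.tendsto_integral_filter_of_dominated_convergence (fun _ => C)
        (Eventually.of_forall fun n => ?_) (Eventually.of_forall fun n => ?_)
        intervalIntegrable_const (Eventually.of_forall fun s _ => ?_)
      · exact (continuous_iff_continuousAt.2 fun s =>
          (hasDerivAt_exp_smul_apply (B n) s (B n x)).continuousAt).aestronglyMeasurable
      · refine Eventually.of_forall fun s _ => ?_
        rw [hnorm]
        exact hC ⟨n, rfl⟩
      · have h2 : Tendsto (fun n => NormedSpace.exp (s • B n) (B n x - y)) atTop (𝓝 0) := by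
          rw [tendsto_zero_iff_norm_tendsto_zero]
          simp only [hnorm]
          simpa using ((hlim x y hxy).sub_const y).norm
        simpa using h2.add (hU s y)
    refine tendsto_nhds_unique ?_ h1
    simp only [integral_exp_smul_apply]
    exact (hU t x).sub_const x
  have hlip : ∀ x y, (x, y) ∈ Γ → ∀ s t, ‖U t x - U s x‖ ≤ |t - s| * ‖y‖ := by
    intro x y hxy s t
    refine le_of_tendsto_of_tendsto' ((hU t x).sub (hU s x)).norm
      ((hlim x y hxy).norm.const_mul _) fun n => ?_
    have : NormedSpace.exp (t • B n) x =
        NormedSpace.exp (s • B n) (NormedSpace.exp ((t - s) • B n) x) := by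
      rw [← exp_add_apply, ← add_smul, add_sub_cancel]
      exact ((Commute.refl (B n)).smul_left _).smul_right _
    rw [this, ← map_sub, hnorm]
    exact norm_exp_smul_sub_le (hB n) _ _
  have hcont : ∀ x, Continuous fun t => U t x := by
    intro x
    -- Orbits of domain vectors are Lipschitz, and every orbit is a uniform limit of such orbits
    -- since each `U t` is an isometry.
    refine continuous_of_uniform_approx_of_continuous fun u hu => ?_
    obtain ⟨ε, hε, hu⟩ := Metric.mem_uniformity_dist.1 hu
    obtain ⟨z, ⟨y, hzy⟩, hxz⟩ := h.dense.exists_dist_lt x hε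
    refine ⟨fun t => U t z, ?_, fun t => hu ?_⟩
    · refine (LipschitzWith.of_dist_le_mul (K := ‖y‖₊) fun t s => ?_).continuous
      rw [dist_eq_norm, Real.dist_eq, mul_comm]
      exact hlip z y hzy s t
    · rwa [dist_eq_norm, ← map_sub, hUn, ← dist_eq_norm]
  refine ⟨U, ?_, fun s t => ?_, hUn, hcont, hUint⟩
  · ext x
    refine tendsto_nhds_unique (hU 0 x) ?_
    simp
  · ext x
    refine tendsto_nhds_unique (hU (s + t) x) ?_
    have h2 : Tendsto (fun n => NormedSpace.exp (s • B n) (NormedSpace.exp (t • B n) x - U t x))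
        atTop (𝓝 0) := by
      rw [tendsto_zero_iff_norm_tendsto_zero]
      simp only [hnorm]
      simpa using ((hU t x).sub_const (U t x)).norm
    have h3 := h2.add (hU s (U t x))
    rw [zero_add] at h3
    refine h3.congr fun n => ?_
    rw [map_sub, sub_add_cancel, add_smul, exp_add_apply]
    exact ((Commute.refl (B n)).smul_left _).smul_right _

end Stone

/-! ### Calculus of the orthogonal group and its generator. -/

namespace IsOrthogonalGroup

variable {H : Type*} [NormedAddCommGroup H] [InnerProductSpace ℝ H]
  {U : ℝ → H →L[ℝ] H} {Γ : Submodule ℝ (H × H)}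

theorem map_map (hU : IsOrthogonalGroup U Γ) (s t : ℝ) (x : H) : U s (U t x) = U (s + t) x := by
  rw [hU.add]; rfl

theorem zero_apply (hU : IsOrthogonalGroup U Γ) (x : H) : U 0 x = x := by
  rw [hU.zero]; rfl

theorem inner_map_left (hU : IsOrthogonalGroup U Γ) (t : ℝ) (x y : H) :
    inner ℝ (U t x) y = inner ℝ x (U (-t) y) := by
  let V : H →ₗᵢ[ℝ] H := ⟨U t, hU.norm_map t⟩
  have h : inner ℝ (U t x) (U t (U (-t) y)) = inner ℝ x (U (-t) y) := V.inner_map_map x _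
  rwa [hU.map_map, add_neg_cancel, hU.zero_apply] at h

theorem tendsto_map (hU : IsOrthogonalGroup U Γ) {α : Type*} {l : Filter α} {f : α → ℝ}
    {g : α → H} {t : ℝ} {x : H} (hf : Tendsto f l (𝓝 t)) (hg : Tendsto g l (𝓝 x)) :
    Tendsto (fun a => U (f a) (g a)) l (𝓝 (U t x)) := by
  have h1 : Tendsto (fun a => U (f a) (g a - x)) l (𝓝 0) := by
    rw [tendsto_zero_iff_norm_tendsto_zero]
    simp only [hU.norm_map]
    simpa using (hg.sub_const x).norm
  simpa using h1.add (((hU.continuous x).tendsto t).comp hf)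

variable [CompleteSpace H]

theorem hasDerivAt (hU : IsOrthogonalGroup U Γ) {x y : H} (hxy : (x, y) ∈ Γ) (t : ℝ) :
    HasDerivAt (fun t => U t x) (U t y) t := by
  have h := intervalIntegral.integral_hasDerivAt_right (a := 0) (b := t)
    ((hU.continuous y).intervalIntegrable _ _)
    ((hU.continuous y).stronglyMeasurableAtFilter _ _) (hU.continuous y).continuousAt
  refine (h.add_const x).congr_of_eventuallyEq (Eventually.of_forall fun s => ?_)
  dsimp only
  rw [← hU.integral x y hxy, sub_add_cancel]

/-- The generator is no larger than `Γ`: differentiating `⟪U t x, a⟫ = ⟪x, U (-t) a⟫` at `0` puts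
`(x, y)` in minus the adjoint of `Γ`, which is `Γ`. -/
theorem mem_iff_hasDerivAt (hU : IsOrthogonalGroup U Γ) (hΓ : IsSkewAdjoint Γ) (x y : H) :
    (x, y) ∈ Γ ↔ HasDerivAt (fun t => U t x) y 0 := by
  refine ⟨fun h => by simpa only [hU.zero_apply] using hU.hasDerivAt h 0, fun h => ?_⟩
  rw [hΓ.mem_iff]
  intro a b hab
  have h1 : HasDerivAt (fun t => inner ℝ (U t x) a) (inner ℝ y a) 0 := by
    simpa using h.inner ℝ (hasDerivAt_const (0 : ℝ) a)
  have h2 : HasDerivAt (fun t => inner ℝ x (U (-t) a)) (inner ℝ x (-b)) 0 := by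
    have h3 : HasDerivAt (fun t => U (-t) a) (-b) 0 := by
      have := HasDerivAt.scomp (0 : ℝ) (hU.hasDerivAt hab (-0)) (hasDerivAt_neg (0 : ℝ))
      rw [neg_zero, hU.zero_apply, neg_one_smul] at this
      exact this
    simpa using (hasDerivAt_const (0 : ℝ) x).inner ℝ h3
  have h4 := h1.unique (h2.congr_of_eventuallyEq
    (Eventually.of_forall fun t => hU.inner_map_left t x a))
  rw [inner_neg_right] at h4
  rw [real_inner_comm x b, real_inner_comm y a, h4, neg_neg]

/-- Holds for every `x`, not only in the domain, by testing against `Γ` and moving the group to the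
other side. It yields both the invariance of `M` and the regularity of the position `σ`. -/
theorem integral_mem (hU : IsOrthogonalGroup U Γ) (hΓ : IsSkewAdjoint Γ) (x : H) (s : ℝ) :
    (∫ r in (0 : ℝ)..s, U r x, U s x - x) ∈ Γ := by
  rw [hΓ.mem_iff]
  intro a b hab
  have hi : ∀ z, IntervalIntegrable (fun r => U r z) volume 0 s := fun z =>
    (hU.continuous z).intervalIntegrable _ _
  have hi' : IntervalIntegrable (fun r => U (-r) b) volume 0 s :=
    ((hU.continuous b).comp continuous_neg).intervalIntegrable _ _
  have h1 : inner ℝ b (∫ r in (0 : ℝ)..s, U r x) = ∫ r in (0 : ℝ)..s, inner ℝ x (U (-r) b) := by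
    have := (innerSL ℝ b).intervalIntegral_comp_comm (hi x)
    simp only [innerSL_apply_apply] at this
    rw [← this]
    congr 1
    ext r
    rw [real_inner_comm, hU.inner_map_left]
  have h2 : ∫ r in (0 : ℝ)..s, inner ℝ x (U (-r) b) = inner ℝ x (∫ r in (0 : ℝ)..s, U (-r) b) := by
    have := (innerSL ℝ x).intervalIntegral_comp_comm hi'
    simpa only [innerSL_apply_apply] using this
  have h3 : ∫ r in (0 : ℝ)..s, U (-r) b = -(U (-s) a - a) := by
    rw [hU.integral a b hab, intervalIntegral.integral_comp_neg (fun r => U r b), neg_zero,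
      intervalIntegral.integral_symm]
  rw [h1, h2, h3, inner_neg_right, inner_sub_right, inner_sub_right, ← hU.inner_map_left,
    real_inner_comm, real_inner_comm x a]

/-- Split the slope into that of `v`, transported by `U (τ - r)`, and that of the orbit of the fixed
vector `v s`. Membership in the domain is needed only at the point `s`. -/
theorem hasDerivAt_map_sub (hU : IsOrthogonalGroup U Γ) {v : ℝ → H} {v' b : H} (τ s : ℝ)
    (hv : HasDerivAt v v' s) (hb : (v s, b) ∈ Γ) :
    HasDerivAt (fun s => U (τ - s) (v s)) (U (τ - s) (v' - b)) s := by
  have h1 : HasDerivAt (fun r => U (τ - r) (v s)) (-U (τ - s) b) s := by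
    have := HasDerivAt.scomp s (hU.hasDerivAt hb (τ - s)) ((hasDerivAt_id s).const_sub τ)
    rwa [neg_one_smul] at this
  rw [hasDerivAt_iff_tendsto_slope] at h1 hv ⊢
  have h2 : Tendsto (fun r => U (τ - r) (slope v s r)) (𝓝[≠] s) (𝓝 (U (τ - s) v')) :=
    hU.tendsto_map (((continuous_const.sub continuous_id).tendsto s).mono_left
      nhdsWithin_le_nhds) hv
  rw [map_sub, sub_eq_add_neg]
  refine (h2.add h1).congr fun r => ?_
  simp only [slope_def_module, map_smul, map_sub]
  rw [← smul_add]
  congr 1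
  abel

end IsOrthogonalGroup

/-! ### The wave operator as a skew-adjoint block operator on `K × K`. -/

section Block

variable {K : Type*} [NormedAddCommGroup K] [InnerProductSpace ℝ K]

/-- The graph of the block operator `(p, q) ↦ (R q, -R p)` on `K × K`. -/
def blockGraph (R : K →ₗ.[ℝ] K) : Submodule ℝ (WithLp 2 (K × K) × WithLp 2 (K × K)) where
  carrier := {p | (p.1.snd, p.2.fst) ∈ R.graph ∧ (p.1.fst, -p.2.snd) ∈ R.graph}
  add_mem' := fun {p q} hp hq => by
    refine ⟨R.graph.add_mem hp.1 hq.1, ?_⟩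
    have := R.graph.add_mem hp.2 hq.2
    rwa [Prod.mk_add_mk, ← neg_add] at this
  zero_mem' := by
    refine ⟨R.graph.zero_mem, ?_⟩
    have : ((0 : K), -(0 : K)) ∈ R.graph := by
      rw [neg_zero]
      exact R.graph.zero_mem
    exact this
  smul_mem' := fun c p hp => by
    refine ⟨R.graph.smul_mem c hp.1, ?_⟩
    have := R.graph.smul_mem c hp.2
    rwa [Prod.smul_mk, smul_neg] at this

theorem mem_blockGraph {R : K →ₗ.[ℝ] K} {x y : WithLp 2 (K × K)} :
    (x, y) ∈ blockGraph R ↔ (x.snd, y.fst) ∈ R.graph ∧ (x.fst, -y.snd) ∈ R.graph := Iff.rfl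

theorem isSkewAdjoint_blockGraph [CompleteSpace K] {R : K →ₗ.[ℝ] K} (hR : IsSelfAdjoint R) :
    IsSkewAdjoint (blockGraph R) where
  mem_iff x y := by
    simp only [mem_blockGraph, WithLp.prod_inner_apply]
    constructor
    · rintro ⟨h1, h2⟩ a b ⟨h3, h4⟩
      have h5 := (mem_graph_iff_of_isSelfAdjoint hR _ _).1 h1 _ _ h4
      have h6 := (mem_graph_iff_of_isSelfAdjoint hR _ _).1 h2 _ _ h3
      rw [inner_neg_left] at h5
      rw [inner_neg_right] at h6
      change inner ℝ b.fst x.fst + inner ℝ b.snd x.snd =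
        -(inner ℝ a.fst y.fst + inner ℝ a.snd y.snd)
      linarith
    · intro h
      constructor
      · rw [mem_graph_iff_of_isSelfAdjoint hR]
        intro a b hab
        have := h (WithLp.toLp 2 (a, 0)) (WithLp.toLp 2 (0, -b))
          ⟨R.graph.zero_mem, by simpa using hab⟩
        simpa using this
      · rw [mem_graph_iff_of_isSelfAdjoint hR]
        intro a b hab
        have := h (WithLp.toLp 2 (0, a)) (WithLp.toLp 2 (b, 0))
          ⟨hab, by simp⟩
        simpa using this
  dense := by
    have h := DenseRange.dense_image (f := WithLp.toLp 2)
      (WithLp.toLp_surjective 2).denseRange (WithLp.prod_continuous_toLp 2 K K)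
      (hR.dense_domain.prod hR.dense_domain)
    refine h.mono ?_
    rintro _ ⟨⟨p, q⟩, ⟨hp, hq⟩, rfl⟩
    refine ⟨WithLp.toLp 2 (R ⟨q, hq⟩, -R ⟨p, hp⟩), R.mem_graph ⟨q, hq⟩, ?_⟩
    change (p, - -R ⟨p, hp⟩) ∈ R.graph
    rw [neg_neg]
    exact R.mem_graph ⟨p, hp⟩

end Block

/-- Derivatives in the possibly incomplete state space can thus be tested in `K × K` and carried to
the completion. -/
theorem _root_.LinearIsometry.hasDerivAt_comp_iff {E F : Type*} [NormedAddCommGroup E] [NormedSpace ℝ E]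
    [NormedAddCommGroup F] [NormedSpace ℝ F] (ι : E →ₗᵢ[ℝ] F) {f : ℝ → E} {f' : E} {t : ℝ} :
    HasDerivAt (fun s => ι (f s)) (ι f') t ↔ HasDerivAt f f' t := by
  rw [hasDerivAt_iff_isLittleO, hasDerivAt_iff_isLittleO, ← Asymptotics.isLittleO_norm_left,
    ← Asymptotics.isLittleO_norm_left (f' := fun x' => f x' - f t - (x' - t) • f')]
  simp only [← map_sub, ← map_smul, ι.norm_map]

/-! ### Embedding of the state space and restriction of the group. -/

namespace PositiveSelfAdjoint

variable {K : Type*} [NormedAddCommGroup K] [InnerProductSpace ℝ K] [CompleteSpace K]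
  (S : PositiveSelfAdjoint K)

theorem norm_halfDomain (y : S.HalfDomain) : ‖y‖ = ‖S.sqrtMap y‖ := by
  have h : inner ℝ y y = inner ℝ (S.sqrtMap y) (S.sqrtMap y) := rfl
  rw [real_inner_self_eq_norm_sq, real_inner_self_eq_norm_sq] at h
  exact (sq_eq_sq₀ (norm_nonneg _) (norm_nonneg _)).1 h

/-- The isometric embedding `(y, z) ↦ (S^{1/2} y, z)` of the state space into `K × K`. -/
noncomputable def embed : S.State →ₗᵢ[ℝ] WithLp 2 (K × K) where
  toFun w := WithLp.toLp 2 (S.sqrtMap w.fst, w.snd)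
  map_add' v w := by
    rw [WithLp.add_fst, WithLp.add_snd, map_add, ← WithLp.toLp_add, Prod.mk_add_mk]
  map_smul' c w := by
    rw [WithLp.smul_fst, WithLp.smul_snd, map_smul, RingHom.id_apply, ← WithLp.toLp_smul,
      Prod.smul_mk]
  norm_map' w := by
    change ‖WithLp.toLp 2 (S.sqrtMap w.fst, w.snd)‖ = ‖w‖
    rw [← sq_eq_sq₀ (norm_nonneg _) (norm_nonneg _), WithLp.prod_norm_sq_eq_of_L2,
      WithLp.prod_norm_sq_eq_of_L2, S.norm_halfDomain]
    rfl

theorem embed_fst (w : S.State) : (S.embed w).fst = S.sqrtMap w.fst := rfl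

theorem embed_snd (w : S.State) : (S.embed w).snd = w.snd := rfl

theorem mem_sqrt_graph_iff (x y : K) :
    (x, y) ∈ S.sqrt.graph ↔ ∃ v : S.HalfDomain, S.incl v = x ∧ S.sqrtMap v = y :=
  LinearPMap.mem_graph_iff _

/-- The domains match exactly because `S` is the composition of `S^{1/2}` with itself, including
domains. -/
theorem mem_waveOp_graph_iff (x y : S.State) :
    (x, y) ∈ S.waveOp.graph ↔ (S.embed x, S.embed y) ∈ blockGraph S.sqrt := by
  rw [mem_blockGraph]
  simp only [embed_fst, embed_snd]
  have hS := S.isPositiveSqrt_sqrt.graph_iff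
  constructor
  · intro h
    obtain ⟨⟨x', hx'⟩, hx, rfl⟩ := (LinearPMap.mem_graph_iff _).1 h
    obtain rfl : x' = x := hx
    refine ⟨S.sqrt.mem_graph ⟨x'.snd, hx'.2⟩, ?_⟩
    change (S.sqrtMap x'.fst, - -S.op ⟨S.incl x'.fst, hx'.1⟩) ∈ S.sqrt.graph
    rw [neg_neg]
    obtain ⟨z, h1, h2⟩ := (hS _ _).1 (S.op.mem_graph ⟨S.incl x'.fst, hx'.1⟩)
    have : S.sqrtMap x'.fst = z :=
      LinearPMap.mem_graph_snd_inj _ ((S.mem_sqrt_graph_iff _ _).2 ⟨_, rfl, rfl⟩) h1 rfl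
    rwa [this]
  · rintro ⟨h1, h2⟩
    have h3 := (hS (S.incl x.fst) (-y.snd)).2
      ⟨S.sqrtMap x.fst, (S.mem_sqrt_graph_iff _ _).2 ⟨_, rfl, rfl⟩, h2⟩
    obtain ⟨z, hz, hz'⟩ := (LinearPMap.mem_graph_iff _).1 h3
    obtain ⟨v, hv, hv'⟩ := (S.mem_sqrt_graph_iff _ _).1 h1
    have hvy : v = y.fst := S.sqrt_injective hv'
    have hx : x ∈ S.waveOp.domain :=
      ⟨LinearPMap.mem_domain_of_mem_graph h3, LinearPMap.mem_domain_of_mem_graph h1⟩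
    refine (LinearPMap.mem_graph_iff _).2 ⟨⟨x, hx⟩, rfl, ?_⟩
    apply WithLp.ofLp_injective 2
    refine Prod.ext ?_ ?_
    · exact (Subtype.ext hv.symm : (⟨x.snd, hx.2⟩ : S.sqrt.domain) = v).trans hvy
    · change -S.op ⟨S.incl x.fst, hx.1⟩ = y.snd
      have : (⟨S.incl x.fst, hx.1⟩ : S.op.domain) = z := Subtype.ext hz.symm
      rw [this, hz', neg_neg]

/-- The group generated by the wave operator, as the restriction of an orthogonal group
on `K × K`. -/
theorem exists_waveGroup : ∃ (U : ℝ → WithLp 2 (K × K) →L[ℝ] WithLp 2 (K × K))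
    (T : ℝ → S.State →L[ℝ] S.State), IsOrthogonalGroup U (blockGraph S.sqrt) ∧
      IsContractionGroupGeneratedBy T S.waveOp ∧ ∀ t x, S.embed (T t x) = U t (S.embed x) := by
  have hΓ := isSkewAdjoint_blockGraph S.isPositiveSqrt_sqrt.isSelfAdjoint
  obtain ⟨U, hU⟩ := hΓ.exists_group
  -- The image of `M` is the range of `S^{1/2}` times `K`. It is invariant because the first
  -- component of `U t x - x` is `S^{1/2}` applied to the second component of `∫ U r x`.
  have hex : ∀ t x, ∃ z, S.embed z = U t (S.embed x) := by
    intro t x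
    obtain ⟨v, -, hv⟩ := (S.mem_sqrt_graph_iff _ _).1
      (mem_blockGraph.1 (hU.integral_mem hΓ (S.embed x) t)).1
    refine ⟨WithLp.toLp 2 (v + x.fst, (U t (S.embed x)).snd), ?_⟩
    apply WithLp.ofLp_injective 2
    refine Prod.ext ?_ rfl
    change S.sqrtMap (v + x.fst) = (U t (S.embed x)).fst
    rw [map_add, hv, WithLp.sub_fst, embed_fst, sub_add_cancel]
  choose g hg using hex
  have hinj := S.embed.injective
  let T : ℝ → S.State →L[ℝ] S.State := fun t => LinearMap.mkContinuous
    { toFun := g t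
      map_add' := fun x y => hinj (by simp only [hg, map_add])
      map_smul' := fun c x => hinj (by simp only [hg, map_smul, RingHom.id_apply]) } 1
    fun x => by
      change ‖g t x‖ ≤ 1 * ‖x‖
      rw [one_mul, ← S.embed.norm_map, hg, hU.norm_map, S.embed.norm_map]
  have hT : ∀ t x, S.embed (T t x) = U t (S.embed x) := hg
  refine ⟨U, T, hU, ⟨?_, fun s t => ?_, fun t => ?_, fun x => ?_, fun x y => ?_⟩, hT⟩
  · ext1 x
    exact hinj (by rw [hT, hU.zero_apply]; rfl)
  · ext1 x
    refine hinj ?_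
    rw [hT, ContinuousLinearMap.comp_apply, hT, hT, hU.map_map]
  · exact LinearMap.mkContinuous_norm_le _ zero_le_one _
  · rw [S.embed.isometry.isEmbedding.continuous_iff]
    simpa only [Function.comp_def, hT] using hU.continuous (S.embed x)
  · rw [S.mem_waveOp_graph_iff, hU.mem_iff_hasDerivAt hΓ, ← S.embed.hasDerivAt_comp_iff]
    simp only [hT]

end PositiveSelfAdjoint

/-! ### The cutoff control and its energy. -/

namespace PositiveSelfAdjoint

variable {K : Type*} [NormedAddCommGroup K] [InnerProductSpace ℝ K] [CompleteSpace K]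
  (S : PositiveSelfAdjoint K)

theorem control_fst (a : K) : (S.control a).fst = 0 := rfl

theorem control_snd (a : K) : (S.control a).snd = a := rfl

theorem norm_control (a : K) : ‖S.control a‖ = ‖a‖ := by
  rw [← sq_eq_sq₀ (norm_nonneg _) (norm_nonneg _), WithLp.prod_norm_sq_eq_of_L2, control_fst,
    control_snd, norm_zero, zero_pow two_ne_zero, zero_add]

/-- The control operator `u ↦ (0, u)` as a linear isometry. -/
noncomputable def controlₗᵢ : K →ₗᵢ[ℝ] S.State := ⟨S.control, S.norm_control⟩

variable {S}
variable {U : ℝ → WithLp 2 (K × K) →L[ℝ] WithLp 2 (K × K)} {T : ℝ → S.State →L[ℝ] S.State}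

/-- The group of wave operators on `K × K` together with its restriction to the state space. -/
structure IsWaveGroup (U : ℝ → WithLp 2 (K × K) →L[ℝ] WithLp 2 (K × K))
    (T : ℝ → S.State →L[ℝ] S.State) : Prop where
  orthogonal : IsOrthogonalGroup U (blockGraph S.sqrt)
  generated : IsContractionGroupGeneratedBy T S.waveOp
  embed_map : ∀ t x, S.embed (T t x) = U t (S.embed x)

/-- The velocity of the free wave with initial position `0` and initial velocity `a`. -/
noncomputable def velocity (T : ℝ → S.State →L[ℝ] S.State) (a : K) (s : ℝ) : K :=
  (T s (S.control a)).snd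

/-- The position of the free wave with initial position `0` and initial velocity `a`. -/
noncomputable def position (T : ℝ → S.State →L[ℝ] S.State) (a : K) (s : ℝ) : K :=
  ∫ r in (0 : ℝ)..s, velocity T a r

namespace IsWaveGroup

theorem norm_velocity_le (h : IsWaveGroup U T) (a : K) (s : ℝ) : ‖velocity T a s‖ ≤ ‖a‖ := by
  refine (WithLp.norm_snd_le _ (T s (S.control a))).trans ?_
  rw [← S.embed.norm_map, h.embed_map, h.orthogonal.norm_map, S.embed.norm_map, S.norm_control]

theorem continuous_velocity (h : IsWaveGroup U T) (a : K) : Continuous (velocity T a) :=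
  (WithLp.sndL 2 ℝ S.HalfDomain K).continuous.comp (h.generated.continuous (S.control a))

theorem hasDerivAt_position (h : IsWaveGroup U T) (a : K) (s : ℝ) :
    HasDerivAt (position T a) (velocity T a s) s :=
  intervalIntegral.integral_hasDerivAt_right
    ((h.continuous_velocity a).intervalIntegrable _ _)
    ((h.continuous_velocity a).stronglyMeasurableAtFilter _ _)
    (h.continuous_velocity a).continuousAt

theorem continuous_position (h : IsWaveGroup U T) (a : K) : Continuous (position T a) :=
  continuous_iff_continuousAt.2 fun s => (h.hasDerivAt_position a s).continuousAt

theorem norm_position_le (h : IsWaveGroup U T) (a : K) {s : ℝ} (hs : 0 ≤ s) :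
    ‖position T a s‖ ≤ s * ‖a‖ := by
  have := intervalIntegral.norm_integral_le_of_norm_le_const (a := 0) (b := s) (C := ‖a‖)
    (f := velocity T a) fun r _ => h.norm_velocity_le a r
  rwa [sub_zero, abs_of_nonneg hs, mul_comm] at this

/-- This is `A (0, σ) = (σ, 0)`, where `(σ, 0)` is written as the free wave `(σ, c)` minus `(0, c)`.
In particular `σ(s)` lies in the domain of `S^{1/2}`. -/
theorem embed_control_position_mem (h : IsWaveGroup U T) (a : K) (s : ℝ) :
    (S.embed (S.control (position T a s)),
      S.embed (T s (S.control a)) - S.embed (S.control (velocity T a s))) ∈ blockGraph S.sqrt := by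
  have h1 := h.orthogonal.integral_mem
    (isSkewAdjoint_blockGraph S.isPositiveSqrt_sqrt.isSelfAdjoint) (S.embed (S.control a)) s
  rw [mem_blockGraph] at h1 ⊢
  have h2 : (∫ r in (0 : ℝ)..s, U r (S.embed (S.control a))).snd = position T a s := by
    have := (WithLp.sndL 2 ℝ K K).intervalIntegral_comp_comm
      ((h.orthogonal.continuous (S.embed (S.control a))).intervalIntegrable (μ := volume) 0 s)
    refine this.symm.trans ?_
    simp only [← h.embed_map]
    rfl
  rw [h2, ← h.embed_map] at h1
  simp only [WithLp.sub_fst, WithLp.sub_snd, embed_fst, embed_snd, control_fst, control_snd,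
    map_zero, sub_zero, velocity, sub_self, neg_zero] at h1 ⊢
  exact ⟨h1.1, S.sqrt.graph.zero_mem⟩

/-- For a scalar cutoff `θ`, the product of `θ` with the free wave solves the wave equation with
control `2 θ' c + θ'' σ`, where `c` and `σ` are the velocity and position of the free wave. -/
theorem hasDerivAt_cutoff (h : IsWaveGroup U T) (a : K) {θ θ' θ'' : ℝ → ℝ}
    (hθ : ∀ s, HasDerivAt θ (θ' s) s) (hθ' : ∀ s, HasDerivAt θ' (θ'' s) s) (τ s : ℝ) :
    HasDerivAt (fun s => T (τ - s) (θ s • T s (S.control a) + θ' s • S.control (position T a s)))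
      (T (τ - s) (S.control ((2 * θ' s) • velocity T a s + θ'' s • position T a s))) s := by
  rw [← S.embed.hasDerivAt_comp_iff]
  have hpos : HasDerivAt (fun s => S.embed (S.control (position T a s)))
      (S.embed (S.control (velocity T a s))) s :=
    (S.embed.comp S.controlₗᵢ).hasDerivAt_comp_iff.2 (h.hasDerivAt_position a s)
  have h1 := h.orthogonal.hasDerivAt_map_sub τ s hpos (h.embed_control_position_mem a s)
  -- Transported by `T (τ - s)`, the free wave becomes the constant `T τ (0, a)`, so only `θ` is
  -- differentiated in the first term. The resulting multiple of the free wave cancels against the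
  -- one from `A (0, σ)`, leaving `2θ'c`.
  have h2 := ((hθ s).smul_const (U τ (S.embed (S.control a)))).add ((hθ' s).smul h1)
  have h3 : U τ (S.embed (S.control a)) = U (τ - s) (S.embed (T s (S.control a))) := by
    rw [h.embed_map, h.orthogonal.map_map, sub_add_cancel]
  refine (h2.congr_of_eventuallyEq (Eventually.of_forall fun r => ?_)).congr_deriv ?_
  · simp only [h.embed_map, map_add, map_smul, h.orthogonal.map_map, sub_add_cancel]
    rfl
  · rw [h3]
    simp only [h.embed_map (τ - s), map_add, map_smul, map_sub, mul_smul, two_smul, smul_sub]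
    abel

/-- The variation of constants formula is the fundamental theorem of calculus for `s ↦ T (τ - s) (w
s)` on `[0, τ]`, taken in the completion. -/
theorem isMildSolution_cutoff (h : IsWaveGroup U T) (a : K) {θ θ' θ'' : ℝ → ℝ}
    (hθ : ∀ s, HasDerivAt θ (θ' s) s) (hθ' : ∀ s, HasDerivAt θ' (θ'' s) s)
    (hθ'' : Continuous θ'') (hθ0 : θ 0 = 1) (t : ℝ) :
    S.IsMildSolution t (S.control a)
      (fun s => (2 * θ' s) • velocity T a s + θ'' s • position T a s)
      (fun s => θ s • T s (S.control a) + θ' s • S.control (position T a s)) := by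
  refine ⟨T, h.generated, fun τ _ => ?_⟩
  set u : ℝ → K := fun s => (2 * θ' s) • velocity T a s + θ'' s • position T a s with hu
  have hθ'c : Continuous θ' := continuous_iff_continuousAt.2 fun s => (hθ' s).continuousAt
  have huc : Continuous u :=
    ((continuous_const.mul hθ'c).smul (h.continuous_velocity a)).add
      (hθ''.smul (h.continuous_position a))
  have hfc : Continuous fun s => T (τ - s) (S.control (u s)) := by
    rw [S.embed.isometry.isEmbedding.continuous_iff]
    simp only [Function.comp_def, h.embed_map]
    exact continuous_iff_continuousAt.2 fun s => h.orthogonal.tendsto_map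
      ((continuous_const.sub continuous_id).tendsto s)
      (((S.embed.comp S.controlₗᵢ).continuous.comp huc).tendsto s)
  let κ : S.State →ₗᵢ[ℝ] UniformSpace.Completion S.State := UniformSpace.Completion.toComplₗᵢ
  have hint := intervalIntegral.integral_eq_sub_of_hasDerivAt (a := 0) (b := τ)
    (fun s _ => κ.hasDerivAt_comp_iff.2 (h.hasDerivAt_cutoff a hθ hθ' τ s))
    ((κ.continuous.comp hfc).intervalIntegrable _ _)
  have hT0 : ∀ x, T 0 x = x := fun x => by rw [h.generated.zero]; rfl
  have hp0 : position T a 0 = 0 := intervalIntegral.integral_same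
  simp only [sub_self, sub_zero, hT0, hp0, hθ0, one_smul, map_zero, smul_zero, add_zero] at hint
  refine eq_add_of_sub_eq' ?_
  exact hint.symm

end IsWaveGroup

theorem minimalEnergy_control_le (S : PositiveSelfAdjoint K) (a : K) {t : ℝ} (ht : 0 < t) :
    S.minimalEnergy t (S.control a) ≤ ENNReal.ofReal (6 * ‖a‖ / √t) := by
  obtain ⟨U, T, h1, h2, h3⟩ := S.exists_waveGroup
  have h : IsWaveGroup U T := ⟨h1, h2, h3⟩
  have hd : ∀ s : ℝ, HasDerivAt (fun s => 1 - s / t) (-(1 / t)) s := fun s =>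
    ((hasDerivAt_id s).div_const t).const_sub 1
  -- The double zero at `t` annihilates both `θ` and `θ'`, hence the whole final state.
  have hθ : ∀ s, HasDerivAt (fun s => (1 - s / t) ^ 2) (-(2 / t) * (1 - s / t)) s := fun s =>
    ((hd s).pow 2).congr_deriv (by push_cast; ring)
  have hθ' : ∀ s, HasDerivAt (fun s => -(2 / t) * (1 - s / t)) (2 / t ^ 2) s := fun s =>
    ((hd s).const_mul (-(2 / t))).congr_deriv (by ring)
  have hmild := h.isMildSolution_cutoff a hθ hθ' continuous_const (by simp) t
  set u : ℝ → K := fun s => (2 * (-(2 / t) * (1 - s / t))) • velocity T a s +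
    (2 / t ^ 2) • position T a s with hu
  have huc : Continuous u := by
    have := h.continuous_velocity a
    have := h.continuous_position a
    fun_prop
  -- The constant is `6 = 4 + 2`: `|2θ'| ≤ 4/t` against `|c| ≤ |a|`, and `θ'' = 2/t²` against `|σ| ≤
  -- t|a|`.
  have hub : ∀ s ∈ Ioo 0 t, ‖u s‖ ≤ 6 * ‖a‖ / t := by
    rintro s ⟨hs0, hst⟩
    have e1 : ‖(2 * (-(2 / t) * (1 - s / t))) • velocity T a s‖ ≤ 4 / t * ‖a‖ := by
      rw [norm_smul, Real.norm_eq_abs]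
      refine mul_le_mul ?_ (h.norm_velocity_le a s) (norm_nonneg _) (by positivity)
      have : 0 ≤ 1 - s / t ∧ 1 - s / t ≤ 1 :=
        ⟨sub_nonneg.2 ((div_le_one ht).2 hst.le), by linarith [div_pos hs0 ht]⟩
      rw [show 2 * (-(2 / t) * (1 - s / t)) = -(4 / t * (1 - s / t)) by ring, abs_neg,
        abs_of_nonneg (mul_nonneg (by positivity) this.1)]
      exact mul_le_of_le_one_right (by positivity) this.2
    have e2 : ‖(2 / t ^ 2) • position T a s‖ ≤ 2 / t * ‖a‖ := by
      rw [norm_smul, Real.norm_eq_abs, abs_of_nonneg (by positivity)]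
      calc 2 / t ^ 2 * ‖position T a s‖ ≤ 2 / t ^ 2 * (t * ‖a‖) := by
            gcongr
            exact (h.norm_position_le a hs0.le).trans (by gcongr)
        _ = 2 / t * ‖a‖ := by field_simp
    calc ‖u s‖ ≤ 4 / t * ‖a‖ + 2 / t * ‖a‖ := (norm_add_le _ _).trans (add_le_add e1 e2)
      _ = 6 * ‖a‖ / t := by ring
  refine (iInf₂_le u ?_).trans ((iInf_le _ ⟨_, hmild, by simp [ht.ne']⟩).trans ?_)
  · refine MemLp.of_bound huc.aestronglyMeasurable (6 * ‖a‖ / t) ?_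
    exact (ae_restrict_iff' measurableSet_Ioo).2 (Eventually.of_forall hub)
  · refine ENNReal.ofReal_le_ofReal (Real.sqrt_le_iff.2 ⟨by positivity, ?_⟩)
    have := norm_setIntegral_le_of_norm_le_const (μ := volume) (s := Ioo 0 t)
      (f := fun r => ‖u r‖ ^ 2) (C := (6 * ‖a‖ / t) ^ 2) measure_Ioo_lt_top fun r hr => by
        rw [norm_pow, norm_norm]
        exact pow_le_pow_left₀ (norm_nonneg _) (hub r hr) 2
    refine (le_abs_self _).trans (this.trans (le_of_eq ?_))
    rw [Real.volume_real_Ioo_of_le ht.le, sub_zero, div_pow, div_pow, Real.sq_sqrt ht.le]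
    field_simp

end PositiveSelfAdjoint

end AbstractWave

theorem theoremA1 {K : Type*} [NormedAddCommGroup K] [InnerProductSpace ℝ K] [CompleteSpace K]
    [TopologicalSpace.SeparableSpace K] (S : AbstractWave.PositiveSelfAdjoint K) :
    ∃ C : ℝ, 0 < C ∧ ∀ (k : S.State) (a : K), k = S.control a → ∀ t : ℝ, 0 < t →
      S.minimalEnergy t k ≤ ENNReal.ofReal (C * ‖k‖ / t ^ (1 / 2 : ℝ)) ∧
      C * ‖k‖ / t ^ (1 / 2 : ℝ) = C * ‖a‖ / t ^ (1 / 2 : ℝ) := by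
  refine ⟨6, by norm_num, ?_⟩
  rintro _ a rfl t ht
  rw [S.norm_control, ← Real.sqrt_eq_rpow]
  exact ⟨S.minimalEnergy_control_le a ht, rfl⟩
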